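/- Let $d\ge 1$ and let $\eta$ be a simple point process on $\mathbb{R}^d$, i.e. a random element of the space of locally finite subsets of $\mathbb{R}^d$ with the $\sigma$-field generated by the counting maps $\mu\mapsto\mu(B):=|\mu\cap B|$, $B$ Borel. Assume that $\eta$ is stationary with intensity $\gamma:=\mathbb{E}\,\eta([0,1]^d)\in(0,\infty)$, locally square integrable ($\mathbb{E}\,\eta(B)^2<\infty$ for each bounded Borel set $B$), and ergodic (translation invariant events have probability $0$ or $1$ under the law of $\eta$). *Structure factor.* For bounded Borel sets $B$ let $$\alpha_2^!(B):=\mathbb{E}\,\big|\{(x,y)\in\eta\times\eta: x\neq y,\ x\in[0,1]^d,\ y-x\in B\}\big|,\qquad \beta_2^!:=\alpha_2^!-\gamma^2\lambda_d,$$ where $\lambda_d$ is Lebesgue measure. Assume that $\eta$ has a structure factor $S:\mathbb{R}^d\to\mathbb{R}$, i.e. that $$S(k)=1+\frac1\gamma\int e^{-i\langle k,x\rangle}\,\beta^c(dx),\qquad k\in\mathbb{R}^d,$$ where either (a) $\beta_2^!$ has finite total variation and $\beta^c=\beta_2^!$, or (b) $\beta_2^!=\beta^c+\beta^d$ on bounded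 Borel sets, where $\beta^c$ is the difference of two positive semidefinite signed measures of finite total variation and $\beta^d=\sum_{q\in\mathbb{L}}Q(\cdot-q)-\lambda_d$ for a lattice $\mathbb{L}\subset\mathbb{R}^d$ and a positive semidefinite probability measure $Q$ on $\mathbb{R}^d$. *Scattering intensity.* For $r>0$ let $W_r:=[-r/2,r/2]^d$ and, for $k\in\mathbb{R}^d$, $$\mathcal{S}_r(k):=\frac{1}{\eta(W_r)}\Big|\sum_{x\in\eta\cap W_r}e^{-i\langle k,x\rangle}-\mathbf 1\{k=0\}\gamma r^d\Big|^2,\qquad T_r(k):=r^{-d/2}\sum_{x\in\eta\cap W_r}e^{-i\langle k,x\rangle}-\mathbf 1\{k=0\}\gamma r^{d/2},$$ with $0^{-1}:=0$. *Goodness.* Let $K\subset\mathbb{R}^d$ satisfy $|K\cap\{k,-k\}|=1$ for each $k\in\mathbb{R}^d$, and let $\mathbb{N}=\{1,2,\dots\}$. Assume that $\eta$ is good (with respect to $K$): for each $n$, all pairwise distinct $k_1,\dots,k_n\in K\setminus\{0\}$ and all $H_j:(0,\infty)\to\mathbb{N}^d$ with $2\pi H_j(r)/r\to k_j$ as $r\to\infty$,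 $j=1,\dots,n$, $$\big(T_r(2\pi H_1(r)/r),\dots,T_r(2\pi H_n(r)/r)\big)\xrightarrow{d}(Z_{k_1},\dots,Z_{k_n})\quad\text{as } r\to\infty,$$ where $Z_{k_1},\dots,Z_{k_n}$ are independent complex-valued random variables and the real and imaginary parts of $Z_k$ are independent centered normal random variables with variance $\gamma S(k)/2$ (a normal random variable with variance $0$ is almost surely constant). Then for each $n\in\mathbb{N}$, all pairwise distinct $k_1,\dots,k_n\in K\setminus\{0\}$ and all $H_j:(0,\infty)\to\mathbb{N}^d$ with $2\pi H_j(r)/r\to k_j$ as $r\to\infty$, $j=1,\dots,n$, $$\big(\mathcal{S}_r(2\pi H_1(r)/r),\dots,\mathcal{S}_r(2\pi H_n(r)/r)\big)\xrightarrow{d}(E_{k_1},\dots,E_{k_n})\quad\text{as } r\to\infty,$$ where $E_{k_1},\dots,E_{k_n}$ are independent and $E_k$ is exponentially distributed with mean $S(k)$ ($E_k=0$ almost surely if $S(k)=0$). -/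

import Mathlib

open MeasureTheory ProbabilityTheory Filter Topology
open scoped ENNReal NNReal

noncomputable section

namespace Scattering

/-- Euclidean space of dimension `d`. -/
abbrev E (d : ℕ) := EuclideanSpace ℝ (Fin d)

/-- The locally finite subsets of Euclidean space. -/
def Config (d : ℕ) : Type :=
  {μ : Set (E d) // ∀ B : Set (E d), Bornology.IsBounded B → (μ ∩ B).Finite}

/-- The number of points of `μ` in `B`. -/
def Config.count {d : ℕ} (μ : Config d) (B : Set (E d)) : ℕ∞ := (μ.1 ∩ B).encard

/-- The smallest σ-field making all counting maps `μ ↦ μ(B)`, `B` Borel, measurable. -/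
instance Config.instMeasurableSpace (d : ℕ) : MeasurableSpace (Config d) :=
  ⨆ (B : Set (E d)) (_ : MeasurableSet B),
    MeasurableSpace.comap (fun μ : Config d => μ.count B) ⊤

theorem Config.measurable_count {d : ℕ} {B : Set (E d)} (hB : MeasurableSet B) :
    Measurable (fun μ : Config d => μ.count B) := by
  refine Measurable.mono (comap_measurable _) ?_ le_rfl
  exact le_iSup₂_of_le (f := fun (B : Set (E d)) (_ : MeasurableSet B) =>
    MeasurableSpace.comap (fun μ : Config d => μ.count B) ⊤) B hB le_rfl

/-- The translate `μ + x`. -/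
def Config.shift {d : ℕ} (x : E d) (μ : Config d) : Config d :=
  ⟨(fun y => y + x) '' μ.1, by
    intro B hB
    have h : (fun y => y + x) '' μ.1 ∩ B ⊆
        (fun y => y + x) '' (μ.1 ∩ ((fun y => y + -x) '' B)) := by
      rintro _ ⟨⟨y, hy, rfl⟩, hyB⟩
      exact ⟨y, ⟨hy, _, hyB, by simp⟩, rfl⟩
    refine Set.Finite.subset (Set.Finite.image _ (μ.2 _ ?_)) h
    exact (LipschitzWith.of_dist_le_mul (K := 1) (fun a b => by simp)).isBounded_image hB⟩

theorem Config.count_shift {d : ℕ} (x : E d) (μ : Config d) (B : Set (E d)) :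
    (μ.shift x).count B = μ.count ((fun y => y + x) ⁻¹' B) := by
  unfold Config.count Config.shift
  rw [← Set.image_inter_preimage, (add_left_injective x).encard_image]

theorem Config.measurable_shift {d : ℕ} (x : E d) :
    Measurable (Config.shift x : Config d → Config d) := by
  refine Measurable.of_le_map ?_
  refine iSup₂_le fun B hB => ?_
  rw [MeasurableSpace.comap_le_iff_le_map, MeasurableSpace.map_comp]
  have h := Config.measurable_count (d := d) (B := (fun y => y + x) ⁻¹' B)
    (hB.preimage (by fun_prop))
  have h' : (fun μ : Config d => μ.count B) ∘ Config.shift x =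
      fun μ : Config d => μ.count ((fun y => y + x) ⁻¹' B) :=
    funext fun μ => Config.count_shift x μ B
  rw [MeasurableSpace.le_def, h']
  exact fun s hs => h hs

/-- The cube `[0,1]^d`. -/
def unitCube (d : ℕ) : Set (E d) := {x | ∀ i, x i ∈ Set.Icc (0 : ℝ) 1}

/-- The cube `W_r = [-r/2, r/2]^d`. -/
def cube (d : ℕ) (r : ℝ) : Set (E d) := {x | ∀ i, x i ∈ Set.Icc (-r / 2) (r / 2)}

section PointProcess

variable {Ω : Type*} [MeasurableSpace Ω] {d : ℕ}

/-- The distribution of `η + x` does not depend on `x`. -/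
def IsStationary (P : Measure Ω) (η : Ω → Config d) : Prop :=
  ∀ x : E d, P.map (fun ω => (η ω).shift x) = P.map η

/-- The distribution of `η` is trivial on the σ-field of translation invariant events. -/
def IsErgodic (P : Measure Ω) (η : Ω → Config d) : Prop :=
  ∀ A : Set (Config d), MeasurableSet A → (∀ x : E d, Config.shift x ⁻¹' A = A) →
    P (η ⁻¹' A) = 0 ∨ P (η ⁻¹' A) = 1

/-- `𝔼 η(B)² < ∞` for each bounded Borel set `B`. -/
def IsLocallySquareIntegrable (P : Measure Ω) (η : Ω → Config d) : Prop :=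
  ∀ B : Set (E d), MeasurableSet B → Bornology.IsBounded B →
    ∫⁻ ω, ((η ω).count B : ℝ≥0∞) ^ 2 ∂P < ∞

/-- The intensity `γ = 𝔼 η([0,1]^d)` (only used when this expectation is finite). -/
def intensity (P : Measure Ω) (η : Ω → Config d) : ℝ :=
  (∫⁻ ω, ((η ω).count (unitCube d) : ℝ≥0∞) ∂P).toReal

/-- The reduced second factorial moment measure
`α(B) = 𝔼 #{(x, y) ∈ η × η : x ≠ y, x ∈ [0,1]^d, y - x ∈ B}`, as a set function. -/
def alpha (P : Measure Ω) (η : Ω → Config d) (B : Set (E d)) : ℝ≥0∞ :=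
  ∫⁻ ω, (({p : E d × E d | p.1 ∈ (η ω).1 ∧ p.2 ∈ (η ω).1 ∧ p.1 ≠ p.2 ∧
    p.1 ∈ unitCube d ∧ p.2 - p.1 ∈ B}.encard : ℕ∞) : ℝ≥0∞) ∂P

/-- The covariance measure `β = α - γ² λ`, a signed set function which is considered on
bounded Borel sets only. -/
def beta (P : Measure Ω) (η : Ω → Config d) (B : Set (E d)) : ℝ :=
  (alpha P η B).toReal - intensity P η ^ 2 * (volume B).toReal

/-- The integral of `f` with respect to a finite signed measure. -/
def signedIntegral (ν : SignedMeasure (E d)) (f : E d → ℂ) : ℂ :=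
  ∫ x, f x ∂ν.toJordanDecomposition.posPart - ∫ x, f x ∂ν.toJordanDecomposition.negPart

/-- A finite signed measure `ν` is positive semidefinite if `∫ φ ∗ φ̃ dν ≥ 0` for every continuous
compactly supported `φ`, where `φ̃(x)` is the conjugate of `φ(-x)`. -/
def IsPositiveSemidefinite (ν : SignedMeasure (E d)) : Prop :=
  ∀ φ : E d → ℂ, Continuous φ → HasCompactSupport φ →
    0 ≤ (signedIntegral ν fun x => ∫ y, φ (x + y) * (starRingEnd ℂ) (φ y)).re ∧
    (signedIntegral ν fun x => ∫ y, φ (x + y) * (starRingEnd ℂ) (φ y)).im = 0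

/-- Set functions (on bounded Borel sets) of the form `B ↦ ∑_{q ∈ L} Q(B - q) - λ(B)`, for a lattice
`L` and a positive semidefinite probability measure `Q`. For perturbed lattices `Q` is the law of
the difference of two independent copies of the perturbation. -/
def IsLatticeCovariance (b : Set (E d) → ℝ) : Prop :=
  ∃ (L : Submodule ℤ (E d)) (_ : DiscreteTopology L) (_ : IsZLattice ℝ L)
    (Q : Measure (E d)) (_ : IsProbabilityMeasure Q),
    IsPositiveSemidefinite Q.toSignedMeasure ∧
    ∀ B : Set (E d), MeasurableSet B → Bornology.IsBounded B →
      b B = (∑' q : L, Q {x | (q : E d) + x ∈ B}).toReal - (volume B).toReal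

/-- `S` is the structure factor of `η`:
`S(k) = 1 + γ⁻¹ ∫ exp(-i⟨k, x⟩) βc(dx)`, where either `βc = β` is the covariance measure and has
finite total variation (that is, `β` extends from the bounded Borel sets to a finite signed
measure), or `β = βc + βd` on bounded Borel sets with `βc` a difference of two positive
semidefinite signed measures of finite total variation and `βd` of lattice type. -/
def IsStructureFactor (P : Measure Ω) (η : Ω → Config d) (S : E d → ℝ) : Prop :=
  ∃ (βc : SignedMeasure (E d)) (βd : Set (E d) → ℝ),
    (∀ B : Set (E d), MeasurableSet B → Bornology.IsBounded B → beta P η B = βc B + βd B) ∧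
    (βd = 0 ∨
      ((∃ ν₁ ν₂ : SignedMeasure (E d), IsPositiveSemidefinite ν₁ ∧ IsPositiveSemidefinite ν₂ ∧
        βc = ν₁ - ν₂) ∧ IsLatticeCovariance βd)) ∧
    ∀ k : E d, (S k : ℂ) = 1 + (1 / (intensity P η : ℂ)) *
      signedIntegral βc fun x => Complex.exp (-(Complex.I * (inner ℝ k x : ℝ)))

/-- `∑_{x ∈ η ∩ W_r} exp(-i⟨k, x⟩)`, a finite sum. -/
def expSum (η : Config d) (r : ℝ) (k : E d) : ℂ :=
  ∑ᶠ x ∈ η.1 ∩ cube d r, Complex.exp (-(Complex.I * (inner ℝ k x : ℝ)))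

open Classical in
/-- The empirical Fourier transform with cubic taper,
`T_r(k) = r^{-d/2} ∑_{x ∈ η ∩ W_r} exp(-i⟨k, x⟩) - 1{k = 0} γ r^{d/2}`. -/
def T (P : Measure Ω) (η : Ω → Config d) (r : ℝ) (k : E d) (ω : Ω) : ℂ :=
  (1 / (r ^ ((d : ℝ) / 2) : ℝ) : ℂ) * expSum (η ω) r k -
    (if k = 0 then ((intensity P η * r ^ ((d : ℝ) / 2) : ℝ) : ℂ) else 0)

open Classical in
/-- The scattering intensity
`S_r(k) = η(W_r)⁻¹ |∑_{x ∈ η ∩ W_r} exp(-i⟨k, x⟩) - 1{k = 0} γ r^d|²`, with `0⁻¹ = 0`. -/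
def scatteringIntensity (P : Measure Ω) (η : Ω → Config d) (r : ℝ) (k : E d) (ω : Ω) : ℝ :=
  (((η ω).count (cube d r)).toNat : ℝ)⁻¹ *
    ‖expSum (η ω) r k - (if k = 0 then ((intensity P η * r ^ d : ℝ) : ℂ) else 0)‖ ^ 2

/-- The wave vector `2πH/r`. -/
def waveVector (r : ℝ) (H : Fin d → ℕ+) : E d :=
  WithLp.toLp 2 fun i => 2 * Real.pi * (H i : ℝ) / r

/-- The law of a complex random variable whose real and imaginary part are independent, centered
and normal with variance `v ≥ 0`. -/
def complexGaussian (v : ℝ) : Measure ℂ :=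
  ((gaussianReal 0 v.toNNReal).prod (gaussianReal 0 v.toNNReal)).map
    Complex.measurableEquivRealProd.symm

instance (v : ℝ) : IsProbabilityMeasure (complexGaussian v) :=
  Measure.isProbabilityMeasure_map Complex.measurableEquivRealProd.symm.measurable.aemeasurable

/-- The exponential distribution with mean `m ≥ 0`; it is the point mass at `0` if `m = 0`. -/
def expLaw (m : ℝ) : Measure ℝ :=
  if 0 < m then expMeasure m⁻¹ else Measure.dirac 0

instance (m : ℝ) : IsProbabilityMeasure (expLaw m) := by
  unfold expLaw
  split_ifs with h
  · exact isProbabilityMeasure_expMeasure (inv_pos.mpr h)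
  · infer_instance

/-- `K` contains exactly one of `k` and `-k`, for each `k`. -/
def IsHalfSpace (K : Set (E d)) : Prop :=
  ∀ k : E d, (K ∩ {k, -k}).ncard = 1

/-- `η`, with structure factor `S`, is good (relative to the set `K` of representatives of wave
vectors up to sign): the variables `T_r(2πH_j(r)/r)` converge jointly in distribution to
independent centered complex normal variables, whose components are independent with variance
`γ S(k_j) / 2`. The functions `H_j` matter for `r > 0` only. -/
def IsGood (P : Measure Ω) [IsProbabilityMeasure P] (η : Ω → Config d) (S : E d → ℝ)
    (K : Set (E d)) : Prop :=
  ∀ (n : ℕ) (k : Fin n → E d), Function.Injective k → (∀ j, k j ∈ K \ {0}) →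
    ∀ H : Fin n → ℝ → Fin d → ℕ+,
      (∀ j, Tendsto (fun r => waveVector r (H j r)) atTop (𝓝 (k j))) →
      TendstoInDistribution
        (fun (r : ℝ) (ω : Ω) (j : Fin n) => T P η r (waveVector r (H j r)) ω)
        atTop (id : (Fin n → ℂ) → (Fin n → ℂ)) (fun _ => P)
        (Measure.pi fun j => complexGaussian (intensity P η * S (k j) / 2))

end PointProcess

end Scattering

end

/-! For `r > 0` the scattering intensity factors as `S_r(k) = (η(W_r) / r^d)⁻¹ * |T_r(k)|²`
(`scatteringIntensity_eq`). Goodness gives joint convergence in distribution of the `T_r`. If the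
density `η(W_r) / r^d` tends to `γ` in probability, then Slutsky's lemma and the continuous mapping
theorem give the limit `(γ⁻¹ |Z_{k_j}|²)_j`. The squared modulus of a complex normal variable with
independent components of variance `v` is exponential with mean `2v` (`map_complexGaussian`), so the
limit has independent exponential components with means `2 * (γ S(k_j) / 2) / γ = S(k_j)`.

The remaining work is the ergodic theorem for the density (`tendstoInMeasure_num_cube`). Von
Neumann's mean ergodic theorem, applied to the unit translations in one coordinate direction after
another, shows that `N^{-d} η([0,N)^d)` converges in `L²` to some `g`. Ergodicity concerns events
invariant under all real translations, so `g` is compared with a strictly invariant lower density.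
That density is at most its mean with positive probability, hence almost surely, and by Fatou its
mean is at most `γ`. So `g ≤ γ` almost surely; since `g` has mean `γ`, it equals `γ`. Monotonicity
of counts passes from integer to real side lengths, and stationarity recentres the cube. -/

noncomputable section

namespace Scattering

/-! ### Counts and translations of configurations -/

namespace Config

variable {d : ℕ}

theorem countable (μ : Config d) : μ.1.Countable := by
  have h : μ.1 = ⋃ n : ℕ, μ.1 ∩ Metric.closedBall 0 n := by
    rw [← Set.inter_iUnion, Metric.iUnion_closedBall_nat, Set.inter_univ]
  rw [h]
  exact Set.countable_iUnion fun n => (μ.2 _ Metric.isBounded_closedBall).countable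

/-- The counting measure on the points of a configuration. -/
def toMeasure (μ : Config d) : Measure (E d) := Measure.count.restrict μ.1

theorem toMeasure_apply (μ : Config d) {B : Set (E d)} (hB : MeasurableSet B) :
    μ.toMeasure B = (μ.count B : ℝ≥0∞) := by
  rw [toMeasure, Measure.restrict_apply hB,
    Measure.count_apply (hB.inter μ.countable.measurableSet), Set.inter_comm]
  rfl

theorem measurable_toMeasure : Measurable (toMeasure : Config d → Measure (E d)) := by
  refine Measure.measurable_of_measurable_coe _ fun B hB => ?_
  simp only [toMeasure_apply _ hB]
  have := measurable_count hB
  fun_prop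

theorem count_mono (μ : Config d) {B C : Set (E d)} (h : B ⊆ C) : μ.count B ≤ μ.count C :=
  Set.encard_le_encard (Set.inter_subset_inter_right _ h)

theorem count_ne_top (μ : Config d) {B : Set (E d)} (hB : Bornology.IsBounded B) :
    μ.count B ≠ ⊤ :=
  Set.encard_ne_top_iff.2 (μ.2 B hB)

/-- The number of points in a set, as a real number. -/
def num (B : Set (E d)) (μ : Config d) : ℝ := (μ.count B).toNat

theorem num_nonneg (B : Set (E d)) (μ : Config d) : 0 ≤ μ.num B := Nat.cast_nonneg _

theorem measurable_num {B : Set (E d)} (hB : MeasurableSet B) : Measurable (num B) := by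
  have := measurable_count hB
  unfold num
  fun_prop

theorem num_mono (μ : Config d) {B C : Set (E d)} (h : B ⊆ C) (hC : Bornology.IsBounded C) :
    μ.num B ≤ μ.num C :=
  Nat.cast_le.2 (ENat.toNat_le_toNat (μ.count_mono h) (μ.count_ne_top hC))

theorem ofReal_num (μ : Config d) {B : Set (E d)} (hB : Bornology.IsBounded B) :
    ENNReal.ofReal (μ.num B) = (μ.count B : ℝ≥0∞) := by
  rw [num, ENNReal.ofReal_natCast]
  conv_rhs => rw [← ENat.natCast_toNat (μ.count_ne_top hB)]
  rfl

theorem num_eq_toReal (μ : Config d) {B : Set (E d)} (hB : Bornology.IsBounded B)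
    (hB' : MeasurableSet B) : μ.num B = (μ.toMeasure B).toReal := by
  rw [toMeasure_apply _ hB', ← ofReal_num _ hB, ENNReal.toReal_ofReal (num_nonneg _ _)]

theorem num_shift (x : E d) (μ : Config d) (B : Set (E d)) :
    (μ.shift x).num B = μ.num ((fun y => y + x) ⁻¹' B) := by
  rw [num, count_shift, num]

theorem num_biUnion (μ : Config d) {ι : Type*} (s : Finset ι) (B : ι → Set (E d))
    (hd : (s : Set ι).PairwiseDisjoint B) (hB : ∀ i ∈ s, MeasurableSet (B i))
    (hb : ∀ i ∈ s, Bornology.IsBounded (B i)) :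
    μ.num (⋃ i ∈ s, B i) = ∑ i ∈ s, μ.num (B i) := by
  have hb' : Bornology.IsBounded (⋃ i ∈ s, B i) :=
    (Bornology.isBounded_biUnion s.finite_toSet).2 hb
  rw [num_eq_toReal _ hb' (s.measurableSet_biUnion hB), measure_biUnion_finset hd hB,
    ENNReal.toReal_sum]
  · exact Finset.sum_congr rfl fun i hi => (num_eq_toReal _ (hb i hi) (hB i hi)).symm
  · intro i hi
    rw [toMeasure_apply _ (hB i hi), ← ofReal_num _ (hb i hi)]
    exact ENNReal.ofReal_ne_top

theorem shift_iterate (x : E d) (j : ℕ) : (shift x)^[j] = shift ((j : ℝ) • x) := by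
  induction j with
  | zero =>
    funext μ
    exact Subtype.ext (by simp [shift])
  | succ j ih =>
    funext μ
    rw [Function.iterate_succ_apply', ih]
    refine Subtype.ext ?_
    simp only [shift, Set.image_image]
    congr 1
    funext y
    push_cast
    rw [add_smul, one_smul, add_assoc]

end Config

/-! ### Measurability, volume and boundedness of boxes -/

section Boxes

variable {d : ℕ}

theorem measurableSet_pi_box {s : Fin d → Set ℝ} (hs : ∀ i, MeasurableSet (s i)) :
    MeasurableSet {x : E d | ∀ i, x i ∈ s i} := by
  have : {x : E d | ∀ i, x i ∈ s i} = ⋂ i, (fun x : E d => x i) ⁻¹' s i := by ext; simp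
  rw [this]
  exact MeasurableSet.iInter fun i => hs i |>.preimage (by fun_prop)

theorem volume_pi_box {s : Fin d → Set ℝ} (hs : ∀ i, MeasurableSet (s i)) :
    volume {x : E d | ∀ i, x i ∈ s i} = ∏ i, volume (s i) := by
  rw [← volume_pi_pi, ← (PiLp.volume_preserving_ofLp (Fin d)).measure_preimage
    (MeasurableSet.univ_pi hs).nullMeasurableSet]
  congr 1
  ext x
  simp

theorem isBounded_pi_box {s : Fin d → Set ℝ} (hs : ∀ i, Bornology.IsBounded (s i)) :
    Bornology.IsBounded {x : E d | ∀ i, x i ∈ s i} := by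
  have h := Bornology.IsBounded.pi (S := s) hs
  have := (PiLp.lipschitzWith_toLp 2 (fun _ : Fin d => ℝ)).isBounded_image h
  refine this.subset fun x hx => ⟨WithLp.ofLp x, fun i _ => hx i, rfl⟩

end Boxes

/-! ### The intensity measure -/

section Intensity

variable {d : ℕ} {m : Measure (Config d)}

theorem lintegral_count_lt_top [IsProbabilityMeasure m]
    (hsq : IsLocallySquareIntegrable m (id : Config d → Config d))
    {B : Set (E d)} (hB : MeasurableSet B) (hb : Bornology.IsBounded B) :
    ∫⁻ μ, (μ.count B : ℝ≥0∞) ∂m < ∞ := by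
  refine lt_of_le_of_lt (lintegral_mono fun μ => ?_) (hsq B hB hb)
  simp only [id]
  rw [← Config.ofReal_num _ hb, Config.num, ENNReal.ofReal_natCast, ← Nat.cast_pow,
    Nat.cast_le]
  exact Nat.le_self_pow two_ne_zero _

theorem volume_unitCube (d : ℕ) : volume (unitCube d) = 1 := by
  unfold unitCube
  rw [volume_pi_box fun _ => measurableSet_Icc]
  simp

/-- Campbell's formula for the counting maps of a stationary point process. -/
theorem lintegral_count [IsProbabilityMeasure m]
    (hinv : ∀ x, MeasurePreserving (Config.shift x : Config d → Config d) m m)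
    (hsq : IsLocallySquareIntegrable m (id : Config d → Config d))
    {B : Set (E d)} (hB : MeasurableSet B) :
    ∫⁻ μ, (μ.count B : ℝ≥0∞) ∂m = ENNReal.ofReal (intensity m id) * volume B := by
  -- The mean measure is translation invariant and locally finite, hence a multiple of Lebesgue
  -- measure; the unit cube fixes the factor.
  set M : Measure (E d) := m.bind Config.toMeasure with hM
  have hMB : ∀ {C : Set (E d)}, MeasurableSet C → M C = ∫⁻ μ, (μ.count C : ℝ≥0∞) ∂m := by
    intro C hC
    rw [hM, Measure.bind_apply hC Config.measurable_toMeasure.aemeasurable]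
    simp only [Config.toMeasure_apply _ hC]
  have h1 : M.IsAddLeftInvariant := ⟨fun x => by
    ext C hC
    have hC' : MeasurableSet ((fun y => x + y) ⁻¹' C) := hC.preimage (by fun_prop)
    have hm : Measurable fun μ : Config d => (μ.count C : ℝ≥0∞) := by
      have := Config.measurable_count hC
      fun_prop
    rw [Measure.map_apply (by fun_prop) hC, hMB hC', hMB hC, ← (hinv x).lintegral_comp hm]
    simp only [Config.count_shift, add_comm x]⟩
  have h2 : IsFiniteMeasureOnCompacts M := ⟨fun K hK => by
    rw [hMB hK.measurableSet]
    exact lintegral_count_lt_top hsq hK.measurableSet hK.isBounded⟩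
  have h3 := Measure.isAddLeftInvariant_eq_smul M (volume : Measure (E d))
  have hU : MeasurableSet (unitCube d) := measurableSet_pi_box fun _ => measurableSet_Icc
  have hUb : Bornology.IsBounded (unitCube d) :=
    isBounded_pi_box fun _ => Metric.isBounded_Icc 0 1
  have h4 : ENNReal.ofReal (intensity m id) = M (unitCube d) := by
    rw [hMB hU]
    exact ENNReal.ofReal_toReal (lintegral_count_lt_top hsq hU hUb).ne
  rw [← hMB hB, h4, h3]
  simp [volume_unitCube]

end Intensity

/-! ### Mean ergodic theorem, one coordinate direction at a time -/

section MeanErgodic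

variable {d : ℕ} {m : Measure (Config d)}

/-- The box with side length `N` in the first `s` coordinate directions and `1` in the others. -/
def partialBox (d s N : ℕ) : Set (E d) :=
  {x | ∀ i, x i ∈ Set.Ico (0 : ℝ) (if i.val < s then (N : ℝ) else 1)}

theorem measurableSet_partialBox (d s N : ℕ) : MeasurableSet (partialBox d s N) :=
  measurableSet_pi_box fun _ => measurableSet_Ico

theorem isBounded_partialBox (d s N : ℕ) : Bornology.IsBounded (partialBox d s N) :=
  isBounded_pi_box fun _ => Metric.isBounded_Ico _ _

/-- The integer part of coordinate `s` selects the slab. Half-open sides make the slabs disjoint, so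
that the count of the longer box is exactly a Birkhoff sum. -/
theorem partialBox_succ {s : ℕ} (hs : s < d) (N : ℕ) :
    partialBox d (s + 1) N = ⋃ j ∈ Finset.range N,
      (fun y => y + (j : ℝ) • -EuclideanSpace.single (⟨s, hs⟩ : Fin d) (1 : ℝ)) ⁻¹'
        partialBox d s N := by
  have hlt : ∀ i : Fin d, i ≠ ⟨s, hs⟩ → (i.val < s + 1 ↔ i.val < s) := by
    intro i hi
    have : i.val ≠ s := fun h => hi (Fin.ext h)
    omega
  ext x
  simp only [partialBox, Set.mem_ofPred_eq, Set.mem_iUnion, Finset.mem_range, Set.mem_preimage,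
    exists_prop, PiLp.add_apply, PiLp.smul_apply, PiLp.neg_apply, PiLp.single_apply, smul_eq_mul]
  constructor
  · intro h
    have h0 := h ⟨s, hs⟩
    simp only [lt_add_iff_pos_right, zero_lt_one, if_true] at h0
    refine ⟨⌊x ⟨s, hs⟩⌋₊, (Nat.floor_lt h0.1).2 h0.2, fun i => ?_⟩
    by_cases hi : i = ⟨s, hs⟩
    · subst hi
      have h1 := Nat.floor_le h0.1
      have h2 := Nat.lt_floor_add_one (x ⟨s, hs⟩)
      simp only [if_true, lt_irrefl, if_false, Set.mem_Ico]
      constructor <;> linarith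
    · have := h i
      simpa [hi, hlt i hi] using this
  · rintro ⟨j, hj, h⟩ i
    by_cases hi : i = ⟨s, hs⟩
    · subst hi
      have h0 := h ⟨s, hs⟩
      simp only [if_true, lt_irrefl, if_false, Set.mem_Ico] at h0
      have hj' : (j : ℝ) + 1 ≤ N := by exact_mod_cast hj
      have hj0 : (0 : ℝ) ≤ j := Nat.cast_nonneg j
      simp only [lt_add_iff_pos_right, zero_lt_one, if_true, Set.mem_Ico]
      constructor <;> linarith
    · have := h i
      simpa [hi, hlt i hi] using this

theorem num_partialBox_succ {s : ℕ} (hs : s < d) (N : ℕ) :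
    Config.num (partialBox d (s + 1) N) = fun μ => ∑ j ∈ Finset.range N,
      Config.num (partialBox d s N)
        ((Config.shift (-EuclideanSpace.single (⟨s, hs⟩ : Fin d) (1 : ℝ)))^[j] μ) := by
  funext μ
  have hpre : ∀ j : ℕ, (fun y : E d => y + (j : ℝ) •
      -EuclideanSpace.single (⟨s, hs⟩ : Fin d) (1 : ℝ)) ⁻¹' partialBox d s N =
      (fun y => y - (j : ℝ) • -EuclideanSpace.single (⟨s, hs⟩ : Fin d) (1 : ℝ)) ''
        partialBox d s N := by
    intro j
    ext y
    constructor
    · intro hy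
      exact ⟨_, hy, by simp⟩
    · rintro ⟨z, hz, rfl⟩
      simpa using hz
  rw [partialBox_succ hs, Config.num_biUnion]
  · refine Finset.sum_congr rfl fun j _ => ?_
    rw [Config.shift_iterate, Config.num_shift]
  · intro j _ l _ hjl
    refine Set.disjoint_left.2 fun y hy hy' => hjl ?_
    have h1 := hy ⟨s, hs⟩
    have h2 := hy' ⟨s, hs⟩
    simp only [PiLp.add_apply, PiLp.smul_apply, PiLp.neg_apply, PiLp.single_apply, smul_eq_mul,
      if_true, lt_irrefl, if_false, Set.mem_Ico] at h1 h2
    have h3 : (j : ℝ) < l + 1 := by linarith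
    have h4 : (l : ℝ) < j + 1 := by linarith
    have h3' : j < l + 1 := by exact_mod_cast h3
    have h4' : l < j + 1 := by exact_mod_cast h4
    omega
  · exact fun j _ => (measurableSet_partialBox d s N).preimage (by fun_prop)
  · intro j _
    rw [hpre]
    exact (LipschitzWith.of_dist_le_mul (K := 1) (fun a b => by simp)).isBounded_image
      (isBounded_partialBox d s N)

theorem memLp_num (hsq : IsLocallySquareIntegrable m (id : Config d → Config d))
    {B : Set (E d)} (hB : MeasurableSet B) (hb : Bornology.IsBounded B) :
    MemLp (Config.num B) 2 m := by
  refine ⟨(Config.measurable_num hB).aestronglyMeasurable, ?_⟩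
  rw [eLpNorm_lt_top_iff_lintegral_rpow_enorm_lt_top two_ne_zero ENNReal.ofNat_ne_top]
  convert hsq B hB hb using 3 with μ
  rw [← Config.ofReal_num _ hb, Real.enorm_eq_ofReal (Config.num_nonneg _ _)]
  simp

theorem norm_birkhoffAverage_le {F : Type*} [NormedAddCommGroup F] [NormedSpace ℝ F]
    (U : F →ₗᵢ[ℝ] F) (N : ℕ) (x : F) : ‖birkhoffAverage ℝ U id N x‖ ≤ ‖x‖ := by
  have hU : ∀ j, ‖U^[j] x‖ = ‖x‖ := by
    intro j
    induction j with
    | zero => rfl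
    | succ j ih => rw [Function.iterate_succ_apply', U.norm_map, ih]
  rw [birkhoffAverage, birkhoffSum, norm_smul, norm_inv, Real.norm_natCast]
  calc (N : ℝ)⁻¹ * ‖∑ j ∈ Finset.range N, id (U^[j] x)‖
      ≤ (N : ℝ)⁻¹ * (N * ‖x‖) := by
        refine mul_le_mul_of_nonneg_left ?_ (by positivity)
        refine (norm_sum_le _ _).trans ?_
        simp [hU]
    _ ≤ ‖x‖ := by
        rcases Nat.eq_zero_or_pos N with h | h
        · simp [h]
        · rw [inv_mul_cancel_left₀ (by positivity)]

theorem birkhoffAverage_sub {F : Type*} [NormedAddCommGroup F] [NormedSpace ℝ F]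
    (U : F →ₗᵢ[ℝ] F) (N : ℕ) (x y : F) :
    birkhoffAverage ℝ U id N (x - y) =
      birkhoffAverage ℝ U id N x - birkhoffAverage ℝ U id N y := by
  have h : ∀ j, U^[j] (x - y) = U^[j] x - U^[j] y :=
    fun j => iterate_map_sub (U : F →+ F) j x y
  simp [birkhoffAverage, birkhoffSum, h, Finset.sum_sub_distrib, smul_sub]

/-- Averages of an isometry are contractions, so replacing `x N` by `g` costs at most `‖x N - g‖`,
and the mean ergodic theorem applies to the fixed vector `g`. This allows the same `N` in all
directions. -/
theorem tendsto_birkhoffAverage_of_tendsto {F : Type*} [NormedAddCommGroup F]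
    [InnerProductSpace ℝ F] [CompleteSpace F] (U : F →ₗᵢ[ℝ] F) {x : ℕ → F} {g : F}
    (hx : Tendsto x atTop (𝓝 g)) :
    ∃ h : F, Tendsto (fun N => birkhoffAverage ℝ U id N (x N)) atTop (𝓝 h) := by
  have h1 := ContinuousLinearMap.tendsto_birkhoffAverage_orthogonalProjection
    U.toContinuousLinearMap U.norm_toContinuousLinearMap_le g
  have h2 : Tendsto (fun N => birkhoffAverage ℝ U id N (x N - g)) atTop (𝓝 0) := by
    refine squeeze_zero_norm (fun N => norm_birkhoffAverage_le U N _) ?_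
    exact tendsto_iff_norm_sub_tendsto_zero.1 hx
  refine ⟨_, (h2.add h1).congr fun N => ?_⟩
  rw [birkhoffAverage_sub]
  exact sub_add_cancel _ _

/-- Passing from `s` to `s + 1` averages the previous normalized count over `N` unit translations in
a new direction; for `s = 0` the box does not depend on `N`. -/
theorem exists_tendsto_partialBox
    (hinv : ∀ x, MeasurePreserving (Config.shift x : Config d → Config d) m m)
    (hsq : IsLocallySquareIntegrable m (id : Config d → Config d)) (s : ℕ) (hs : s ≤ d) :
    ∃ g : Lp ℝ 2 m, Tendsto (fun N : ℕ => ((N : ℝ) ^ s)⁻¹ •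
      (memLp_num hsq (measurableSet_partialBox d s N) (isBounded_partialBox d s N)).toLp)
        atTop (𝓝 g) := by
  induction s with
  | zero =>
    refine ⟨(memLp_num hsq (measurableSet_partialBox d 0 0) (isBounded_partialBox d 0 0)).toLp,
      Tendsto.congr (f₁ := fun _ => _) (fun N => ?_) tendsto_const_nhds⟩
    simp [partialBox]
  | succ s ih =>
    obtain ⟨g, hg⟩ := ih (by omega)
    set T := Config.shift (-EuclideanSpace.single (⟨s, hs⟩ : Fin d) (1 : ℝ))
    set U : Lp ℝ 2 m →ₗᵢ[ℝ] Lp ℝ 2 m := Lp.compMeasurePreservingₗᵢ ℝ T (hinv _)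
    obtain ⟨h, hh⟩ := tendsto_birkhoffAverage_of_tendsto U hg
    refine ⟨h, hh.congr fun N => ?_⟩
    have hT : MeasurePreserving T m m := hinv _
    have hU : ∀ j : ℕ, (U^[j] : Lp ℝ 2 m → Lp ℝ 2 m) =
        Lp.compMeasurePreserving T^[j] (hT.iterate j) :=
      fun j => Lp.compMeasurePreserving_iterate hT j
    have hf := memLp_num hsq (measurableSet_partialBox d s N) (isBounded_partialBox d s N)
    have hsum : (memLp_num hsq (measurableSet_partialBox d (s + 1) N)
        (isBounded_partialBox d (s + 1) N)).toLp = ∑ j ∈ Finset.range N, U^[j] hf.toLp := by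
      have h1 : ∀ j, U^[j] hf.toLp = (hf.comp_measurePreserving (hT.iterate j)).toLp := by
        intro j
        rw [hU, Lp.toLp_compMeasurePreserving]
      simp only [h1]
      refine Lp.ext ?_
      refine (MemLp.coeFn_toLp _).trans ?_
      refine EventuallyEq.trans ?_ (Lp.coeFn_finsetSum _ _).symm
      have h2 : ∀ᵐ μ ∂m, ∀ j ∈ Finset.range N,
          ((hf.comp_measurePreserving (hT.iterate j)).toLp : Lp ℝ 2 m) μ =
            (Config.num (partialBox d s N) ∘ T^[j]) μ :=
        (ae_ball_iff (Finset.range N).countable_toSet).2 fun j _ => MemLp.coeFn_toLp _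
      filter_upwards [h2] with μ hμ
      rw [num_partialBox_succ hs, Finset.sum_apply]
      exact (Finset.sum_congr rfl fun j hj => hμ j hj).symm
    rw [hsum, birkhoffAverage, birkhoffSum, pow_succ', mul_inv, mul_smul,
      Finset.smul_sum (r := ((N : ℝ) ^ s)⁻¹)]
    congr 1
    refine Finset.sum_congr rfl fun j _ => ?_
    rw [hU]
    exact ((Lp.compMeasurePreservingₗᵢ ℝ (T^[j]) (hT.iterate j)).map_smul _ _)

end MeanErgodic

/-! ### Identification of the limit by ergodicity -/

section Ergodic

variable {d : ℕ} {m : Measure (Config d)}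

/-- The box `[0,N]^d` enlarged by `a` on all sides. -/
def enlargedBox (d a N : ℕ) : Set (E d) := {x | ∀ i, x i ∈ Set.Icc (-(a : ℝ)) (N + a)}

theorem measurableSet_enlargedBox (d a N : ℕ) : MeasurableSet (enlargedBox d a N) :=
  measurableSet_pi_box fun _ => measurableSet_Icc

theorem volume_enlargedBox (d a N : ℕ) :
    volume (enlargedBox d a N) = ENNReal.ofReal ((N + 2 * a : ℝ) ^ d) := by
  rw [enlargedBox, volume_pi_box fun _ => measurableSet_Icc]
  simp only [Real.volume_Icc, Finset.prod_const, Finset.card_univ, Fintype.card_fin]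
  rw [← ENNReal.ofReal_pow (by have := @Nat.cast_nonneg ℝ; linarith [this N, this a])]
  congr 2
  ring

theorem enlargedBox_mono {a b : ℕ} (h : a ≤ b) (N : ℕ) :
    enlargedBox d a N ⊆ enlargedBox d b N := by
  intro x hx i
  have h' : (a : ℝ) ≤ b := by exact_mod_cast h
  have := hx i
  constructor <;> linarith [this.1, this.2]

theorem preimage_enlargedBox_subset (x : E d) (a N : ℕ) :
    (fun y => y + x) ⁻¹' enlargedBox d a N ⊆ enlargedBox d (a + ⌈‖x‖⌉₊) N := by
  intro y hy i
  have h1 := hy i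
  have h2 : |x i| ≤ ‖x‖ := PiLp.norm_apply_le x i
  have h3 := Nat.le_ceil ‖x‖
  have h4 := abs_le.1 h2
  simp only [PiLp.add_apply] at h1
  push_cast
  constructor <;> linarith [h1.1, h1.2]

/-- A lower density of the configuration along the sequence of boxes with side lengths `ns`; it is
invariant under translations. -/
def lowerDensity (ns : ℕ → ℕ) (μ : Config d) : ℝ≥0∞ :=
  ⨆ a : ℕ, liminf (fun j => ENNReal.ofReal (((ns j : ℝ) ^ d)⁻¹) *
    (μ.count (enlargedBox d a (ns j)) : ℝ≥0∞)) atTop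

theorem measurable_mul_count {B : Set (E d)} (hB : MeasurableSet B) (c : ℝ≥0∞) :
    Measurable fun μ : Config d => c * (μ.count B : ℝ≥0∞) := by
  have := Config.measurable_count hB
  fun_prop

theorem measurable_lowerDensity (ns : ℕ → ℕ) :
    Measurable (lowerDensity ns : Config d → ℝ≥0∞) :=
  Measurable.iSup fun a => Measurable.liminf fun j =>
    measurable_mul_count (measurableSet_enlargedBox d a (ns j)) _

/-- Translating by `x` is absorbed by enlarging the margin by `⌈‖x‖⌉₊`, and the supremum runs over
all margins. -/
theorem lowerDensity_shift_le (ns : ℕ → ℕ) (x : E d) (μ : Config d) :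
    lowerDensity ns (μ.shift x) ≤ lowerDensity ns μ := by
  refine iSup_le fun a => le_iSup_of_le (a + ⌈‖x‖⌉₊) ?_
  refine liminf_le_liminf (Eventually.of_forall fun j => ?_)
  rw [Config.count_shift]
  gcongr
  exact μ.count_mono (preimage_enlargedBox_subset x a (ns j))

theorem lowerDensity_shift (ns : ℕ → ℕ) (x : E d) (μ : Config d) :
    lowerDensity ns (μ.shift x) = lowerDensity ns μ := by
  refine le_antisymm (lowerDensity_shift_le ns x μ) ?_
  have h : (μ.shift x).shift (-x) = μ := by
    refine Subtype.ext ?_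
    simp only [Config.shift, Set.image_image, add_neg_cancel_right, Set.image_id']
  calc lowerDensity ns μ = lowerDensity ns ((μ.shift x).shift (-x)) := by rw [h]
    _ ≤ _ := lowerDensity_shift_le ns (-x) _

theorem tendsto_ratio_pow (a : ℝ) (d : ℕ) :
    Tendsto (fun N : ℕ => ((N : ℝ) ^ d)⁻¹ * ((N : ℝ) + a) ^ d) atTop (𝓝 1) := by
  have h1 : Tendsto (fun N : ℕ => (1 + a / (N : ℝ)) ^ d) atTop (𝓝 ((1 + 0) ^ d)) :=
    ((tendsto_const_div_atTop_nhds_zero_nat a).const_add 1).pow d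
  rw [add_zero, one_pow] at h1
  refine h1.congr' ?_
  filter_upwards [eventually_gt_atTop 0] with N hN
  have : (N : ℝ) ≠ 0 := by positivity
  rw [← inv_pow, ← mul_pow]
  congr 1
  field_simp

/-- Monotone convergence in the margin `a` and Fatou along the boxes; the normalized mean counts are
`γ (N + 2a)^d / N^d`, which tend to `γ`. -/
theorem lintegral_lowerDensity_le [IsProbabilityMeasure m]
    (hinv : ∀ x, MeasurePreserving (Config.shift x : Config d → Config d) m m)
    (hsq : IsLocallySquareIntegrable m (id : Config d → Config d))
    {ns : ℕ → ℕ} (hns : Tendsto ns atTop atTop) :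
    ∫⁻ μ, lowerDensity ns μ ∂m ≤ ENNReal.ofReal (intensity m id) := by
  unfold lowerDensity
  rw [lintegral_iSup]
  · refine iSup_le fun a => (lintegral_liminf_le fun j =>
      measurable_mul_count (measurableSet_enlargedBox d a (ns j)) _).trans ?_
    refine le_of_eq (Tendsto.liminf_eq ?_)
    have h1 : ∀ j, ∫⁻ μ : Config d, ENNReal.ofReal (((ns j : ℝ) ^ d)⁻¹) *
        (μ.count (enlargedBox d a (ns j)) : ℝ≥0∞) ∂m =
        ENNReal.ofReal (intensity m id) *
          ENNReal.ofReal (((ns j : ℝ) ^ d)⁻¹ * ((ns j : ℝ) + 2 * a) ^ d) := by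
      intro j
      have hm := measurable_mul_count (measurableSet_enlargedBox d a (ns j)) 1
      simp only [one_mul] at hm
      rw [lintegral_const_mul _ hm, lintegral_count hinv hsq (measurableSet_enlargedBox d a _),
        volume_enlargedBox, mul_left_comm, ← ENNReal.ofReal_mul (by positivity)]
    simp only [h1]
    have h2 := ENNReal.tendsto_ofReal ((tendsto_ratio_pow (2 * a) d).comp hns)
    have h3 := ENNReal.Tendsto.const_mul (a := ENNReal.ofReal (intensity m id)) h2
      (Or.inr ENNReal.ofReal_ne_top)
    simpa using h3
  · exact fun a => Measurable.liminf fun j =>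
      measurable_mul_count (measurableSet_enlargedBox d a (ns j)) _
  · intro a b hab μ
    refine liminf_le_liminf (Eventually.of_forall fun j => ?_)
    gcongr
    exact μ.count_mono (enlargedBox_mono hab (ns j))

theorem partialBox_subset_enlargedBox (d N : ℕ) : partialBox d d N ⊆ enlargedBox d 0 N := by
  intro x hx i
  have := hx i
  simp only [i.isLt, if_true] at this
  simpa using ⟨this.1, this.2.le⟩

theorem volume_partialBox (d N : ℕ) : volume (partialBox d d N) = ENNReal.ofReal ((N : ℝ) ^ d) := by
  rw [partialBox, volume_pi_box fun _ => measurableSet_Ico]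
  simp [Real.volume_Ico]

/-- The limit along the boxes is at most the lower density (take margin `0`), which ergodicity
bounds by its own mean. The one-sided bound suffices because the mean of the limit is known. -/
theorem ae_le_intensity [IsProbabilityMeasure m]
    (hinv : ∀ x, MeasurePreserving (Config.shift x : Config d → Config d) m m)
    (hsq : IsLocallySquareIntegrable m (id : Config d → Config d))
    (herg : IsErgodic m (id : Config d → Config d))
    {ns : ℕ → ℕ} (hns : Tendsto ns atTop atTop) {g : Config d → ℝ}
    (hg : ∀ᵐ μ ∂m, Tendsto (fun j => ((ns j : ℝ) ^ d)⁻¹ * μ.num (partialBox d d (ns j))) atTop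
      (𝓝 (g μ))) :
    ∀ᵐ μ ∂m, g μ ≤ intensity m id := by
  set A : Set (Config d) := {μ | lowerDensity ns μ ≤ ∫⁻ ν, lowerDensity ns ν ∂m} with hA
  have hAm : MeasurableSet A := measurable_lowerDensity ns measurableSet_Iic
  -- A function cannot exceed its mean almost surely, so this invariant event has positive
  -- probability.
  have hApos : 0 < m A := measure_le_lintegral_pos (measurable_lowerDensity ns).aemeasurable
  have hAinv : ∀ x : E d, Config.shift x ⁻¹' A = A := by
    intro x
    ext μ
    change lowerDensity ns (μ.shift x) ≤ _ ↔ lowerDensity ns μ ≤ _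
    rw [lowerDensity_shift]
  have hA1 : m A = 1 := (herg A hAm hAinv).resolve_left hApos.ne'
  have hAae : ∀ᵐ μ ∂m, μ ∈ A := (mem_ae_iff_prob_eq_one hAm).2 hA1
  filter_upwards [hg, hAae] with μ hμ hμA
  have h1 : ENNReal.ofReal (g μ) ≤ lowerDensity ns μ := by
    refine le_iSup_of_le 0 ?_
    rw [← (ENNReal.tendsto_ofReal hμ).liminf_eq]
    refine liminf_le_liminf (Eventually.of_forall fun j => ?_)
    rw [ENNReal.ofReal_mul (by positivity), Config.ofReal_num _ (isBounded_partialBox d d _)]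
    gcongr
    exact μ.count_mono (partialBox_subset_enlargedBox d (ns j))
  have h2 := h1.trans (hμA.trans (lintegral_lowerDensity_le hinv hsq hns))
  exact (ENNReal.ofReal_le_ofReal_iff ENNReal.toReal_nonneg).1 h2

theorem integral_num [IsProbabilityMeasure m]
    (hinv : ∀ x, MeasurePreserving (Config.shift x : Config d → Config d) m m)
    (hsq : IsLocallySquareIntegrable m (id : Config d → Config d))
    {B : Set (E d)} (hB : MeasurableSet B) (hb : Bornology.IsBounded B) :
    ∫ μ, Config.num B μ ∂m = intensity m id * (volume B).toReal := by
  rw [integral_eq_lintegral_of_nonneg_ae (Eventually.of_forall (Config.num_nonneg B))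
    (Config.measurable_num hB).aestronglyMeasurable]
  simp only [Config.ofReal_num _ hb]
  rw [lintegral_count hinv hsq hB, ENNReal.toReal_mul, ENNReal.toReal_ofReal]
  exact ENNReal.toReal_nonneg

theorem integrable_num [IsProbabilityMeasure m]
    (hsq : IsLocallySquareIntegrable m (id : Config d → Config d))
    {B : Set (E d)} (hB : MeasurableSet B) (hb : Bornology.IsBounded B) :
    Integrable (Config.num B) m :=
  (memLp_num hsq hB hb).integrable (by norm_num)

/-- The mean ergodic theorem for the numbers of points in growing boxes. -/
theorem tendsto_integral_abs_partialBox [IsProbabilityMeasure m]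
    (hinv : ∀ x, MeasurePreserving (Config.shift x : Config d → Config d) m m)
    (hsq : IsLocallySquareIntegrable m (id : Config d → Config d))
    (herg : IsErgodic m (id : Config d → Config d)) :
    Tendsto (fun N : ℕ => ∫ μ, |((N : ℝ) ^ d)⁻¹ * Config.num (partialBox d d N) μ -
      intensity m id| ∂m) atTop (𝓝 0) := by
  obtain ⟨g, hg⟩ := exists_tendsto_partialBox hinv hsq d le_rfl
  set X : ℕ → Config d → ℝ := fun N μ => ((N : ℝ) ^ d)⁻¹ * Config.num (partialBox d d N) μ
  have hF : ∀ N, MemLp (Config.num (partialBox d d N)) 2 m := fun N =>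
    memLp_num hsq (measurableSet_partialBox d d N) (isBounded_partialBox d d N)
  have hX : ∀ N, MemLp (X N) 2 m := fun N => (hF N).const_mul _
  have hXL : ∀ N : ℕ, ((N : ℝ) ^ d)⁻¹ • (hF N).toLp = (hX N).toLp := fun N =>
    (MemLp.toLp_const_smul _ (hF N)).symm
  have hg' : Tendsto (fun N => (hX N).toLp) atTop (𝓝 g) := hg.congr hXL
  have hgi : Integrable g m := (Lp.memLp g).integrable (by norm_num)
  have hXi : ∀ N, Integrable (X N) m := fun N => (hX N).integrable (by norm_num)
  have hnorm : Tendsto (fun N => ∫ μ, |X N μ - g μ| ∂m) atTop (𝓝 0) := by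
    have h0 : Tendsto (fun N => ‖(hX N).toLp - g‖) atTop (𝓝 0) :=
      tendsto_iff_norm_sub_tendsto_zero.1 hg'
    refine squeeze_zero (fun N => integral_nonneg fun μ => abs_nonneg _) (fun N => ?_) h0
    have hm : MemLp (X N - ⇑g) 2 m := (hX N).sub (Lp.memLp g)
    have h1 : ∫ μ, |X N μ - g μ| ∂m = (eLpNorm (X N - ⇑g) 1 m).toReal := by
      rw [eLpNorm_one_eq_lintegral_enorm, ← integral_norm_eq_lintegral_enorm
        hm.aestronglyMeasurable]
      rfl
    have h2 : ‖(hX N).toLp - g‖ = (eLpNorm (X N - ⇑g) 2 m).toReal := by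
      rw [Lp.norm_def]
      congr 1
      refine eLpNorm_congr_ae ((Lp.coeFn_sub _ _).trans ?_)
      filter_upwards [(hX N).coeFn_toLp] with μ hμ
      simp [hμ]
    rw [h1, h2]
    exact ENNReal.toReal_mono hm.eLpNorm_ne_top
      (eLpNorm_le_eLpNorm_of_exponent_le (by norm_num) hm.aestronglyMeasurable)
  have hXint : ∀ N, 0 < N → ∫ μ, X N μ ∂m = intensity m id := by
    intro N hN
    rw [integral_const_mul, integral_num hinv hsq (measurableSet_partialBox d d N)
      (isBounded_partialBox d d N), volume_partialBox, ENNReal.toReal_ofReal (by positivity)]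
    field_simp
  have hgint : ∫ μ, g μ ∂m = intensity m id := by
    -- For `N > 0` all `X N` have mean `γ`, so `L¹` convergence hands this mean to `g`.
    refine (sub_eq_zero.1 (norm_eq_zero.1 (le_antisymm ?_ (norm_nonneg _)))).symm
    refine ge_of_tendsto hnorm ?_
    filter_upwards [eventually_gt_atTop 0] with N hN
    rw [← hXint N hN, ← integral_sub (hXi N) hgi]
    exact norm_integral_le_integral_norm _
  obtain ⟨ns, hns, hae⟩ := (tendstoInMeasure_of_tendsto_Lp hg').exists_seq_tendsto_ae
  have hgle : ∀ᵐ μ ∂m, g μ ≤ intensity m id := by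
    refine ae_le_intensity hinv hsq herg hns.tendsto_atTop ?_
    filter_upwards [hae, ae_all_iff.2 fun N => (hX N).coeFn_toLp] with μ h1 h2
    simpa only [h2] using h1
  -- The nonnegative function `γ - g` has integral zero.
  have hgeq : ∀ᵐ μ ∂m, g μ = intensity m id := by
    have h1 : ∫ μ, (intensity m id - g μ) ∂m = 0 := by
      rw [integral_sub (integrable_const _) hgi, hgint]
      simp
    have h2 := (integral_eq_zero_iff_of_nonneg_ae (by
      filter_upwards [hgle] with μ hμ using sub_nonneg.2 hμ)
      ((integrable_const _).sub hgi)).1 h1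
    filter_upwards [h2] with μ hμ
    exact (sub_eq_zero.1 hμ).symm
  refine hnorm.congr fun N => integral_congr_ae ?_
  filter_upwards [hgeq] with μ hμ
  rw [hμ]

end Ergodic

/-! ### Squared modulus of a complex normal variable -/

theorem gaussianPDF_mul_gaussianPDF {v : ℝ} (hv : 0 < v) (x y : ℝ) :
    gaussianPDF 0 v.toNNReal x * gaussianPDF 0 v.toNNReal y =
      ENNReal.ofReal ((2 * Real.pi * v)⁻¹ * Real.exp (-(x ^ 2 + y ^ 2) / (2 * v))) := by
  rw [gaussianPDF, gaussianPDF, ← ENNReal.ofReal_mul (gaussianPDFReal_nonneg _ _ _),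
    gaussianPDFReal, gaussianPDFReal, Real.coe_toNNReal v hv.le]
  congr 1
  have h : (√(2 * Real.pi * v))⁻¹ * (√(2 * Real.pi * v))⁻¹ = (2 * Real.pi * v)⁻¹ := by
    rw [← mul_inv, Real.mul_self_sqrt (by positivity)]
  rw [mul_mul_mul_comm, h, ← Real.exp_add]
  congr 2
  ring

theorem lintegral_polar_radial (f : ℝ → ℝ≥0∞) (hf : Measurable f) :
    ∫⁻ p : ℝ × ℝ, f (p.1 ^ 2 + p.2 ^ 2) =
      ∫⁻ ρ in Set.Ioi (0 : ℝ), ENNReal.ofReal (2 * Real.pi * ρ) * f (ρ ^ 2) := by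
  rw [← lintegral_comp_polarCoord_symm, polarCoord_target, Measure.volume_eq_prod,
    ← Measure.prod_restrict, lintegral_prod _ (by
      refine Measurable.aemeasurable ?_
      simp only [polarCoord_symm_apply]
      fun_prop)]
  refine setLIntegral_congr_fun measurableSet_Ioi fun ρ hρ => ?_
  have h : ∀ θ : ℝ, (ρ * Real.cos θ) ^ 2 + (ρ * Real.sin θ) ^ 2 = ρ ^ 2 := fun θ => by
    rw [mul_pow, mul_pow, ← mul_add, Real.cos_sq_add_sin_sq, mul_one]
  simp only [polarCoord_symm_apply, h, lintegral_const, Measure.restrict_apply_univ,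
    Real.volume_Ioo, smul_eq_mul]
  rw [mul_right_comm, ← ENNReal.ofReal_mul (le_of_lt hρ)]
  congr 2
  have h2 : ∀ a b : ℝ, a * (b - -b) = 2 * b * a := fun a b => by ring
  exact h2 _ _

/-- Substitution `s = c ρ²`; the Jacobian `2cρ` absorbs the factor `ρ` of polar coordinates. -/
theorem lintegral_Ioi_comp_const_mul_sq {c : ℝ} (hc : 0 < c) (g : ℝ → ℝ≥0∞) :
    ∫⁻ ρ in Set.Ioi (0 : ℝ), ENNReal.ofReal (2 * c * ρ) * g (c * ρ ^ 2) =
      ∫⁻ s in Set.Ioi (0 : ℝ), g s := by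
  have himg : (fun ρ : ℝ => c * ρ ^ 2) '' Set.Ioi 0 = Set.Ioi 0 := by
    ext s
    simp only [Set.mem_image, Set.mem_Ioi]
    constructor
    · rintro ⟨ρ, hρ, rfl⟩
      positivity
    · intro hs
      refine ⟨√(s / c), Real.sqrt_pos.2 (by positivity), ?_⟩
      rw [Real.sq_sqrt (by positivity)]
      field_simp
  have hder : ∀ ρ ∈ Set.Ioi (0 : ℝ),
      HasDerivWithinAt (fun ρ : ℝ => c * ρ ^ 2) (2 * c * ρ) (Set.Ioi 0) ρ := by
    intro ρ _
    have h := ((hasDerivAt_pow 2 ρ).const_mul c).hasDerivWithinAt (s := Set.Ioi 0)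
    exact h.congr_deriv (by simp only [Nat.cast_ofNat, Nat.add_one_sub_one, pow_one]; ring)
  have hinj : Set.InjOn (fun ρ : ℝ => c * ρ ^ 2) (Set.Ioi 0) := by
    intro a ha b hb h
    have h' : a ^ 2 = b ^ 2 := mul_left_cancel₀ hc.ne' h
    exact (pow_left_inj₀ (le_of_lt ha) (le_of_lt hb) two_ne_zero).1 h'
  have h := lintegral_image_eq_lintegral_abs_deriv_mul measurableSet_Ioi hder hinj g
  rw [himg] at h
  rw [h]
  refine setLIntegral_congr_fun measurableSet_Ioi fun ρ hρ => ?_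
  have hρ' : (0 : ℝ) < ρ := hρ
  rw [abs_of_pos (by positivity)]

/-- The planar normal density is radial. In polar coordinates the angle contributes `2π`, and `s = c
ρ²` turns `exp(-ρ² / (2v)) ρ dρ / v` into the exponential density with rate `1 / (2vc)`. -/
theorem map_complexGaussian (v : ℝ) {c : ℝ} (hc : 0 < c) :
    (complexGaussian v).map (fun z : ℂ => c * ‖z‖ ^ 2) = expLaw (2 * v * c) := by
  have hmeas : Measurable fun z : ℂ => c * ‖z‖ ^ 2 := by fun_prop
  rw [complexGaussian, Measure.map_map hmeas
    Complex.measurableEquivRealProd.symm.measurable]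
  have hcomp : ((fun z : ℂ => c * ‖z‖ ^ 2) ∘ Complex.measurableEquivRealProd.symm) =
      fun p : ℝ × ℝ => c * (p.1 ^ 2 + p.2 ^ 2) := by
    funext p
    rw [Function.comp_apply, ← Complex.normSq_eq_norm_sq, Complex.normSq_apply,
      Complex.measurableEquivRealProd_symm_apply, pow_two, pow_two]
  rw [hcomp]
  -- For `v ≤ 0` the variance is truncated to `0`, and both sides are the point mass at `0`.
  rcases le_or_gt v 0 with hv | hv
  · have h : ¬ 0 < 2 * v * c := not_lt.2 (by nlinarith)
    rw [Real.toNNReal_of_nonpos hv, expLaw, if_neg h, gaussianReal_zero_var,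
      Measure.dirac_prod_dirac, Measure.map_dirac' (by fun_prop)]
    simp
  · have hvc : 0 < 2 * v * c := by positivity
    have hv0 : v.toNNReal ≠ 0 := (Real.toNNReal_pos.2 hv).ne'
    rw [expLaw, if_pos hvc]
    ext A hA
    rw [Measure.map_apply (by fun_prop) hA, gaussianReal_of_var_ne_zero _ hv0,
      prod_withDensity (measurable_gaussianPDF _ _) (measurable_gaussianPDF _ _),
      withDensity_apply _ (hA.preimage (by fun_prop)),
      ← lintegral_indicator (hA.preimage (by fun_prop)), expMeasure, gammaMeasure,
      withDensity_apply _ hA, ← lintegral_indicator hA]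
    -- The integrand as a function of the squared radius.
    let f : ℝ → ℝ≥0∞ := fun s =>
      ((fun s => c * s) ⁻¹' A).indicator
        (fun s => ENNReal.ofReal ((2 * Real.pi * v)⁻¹ * Real.exp (-s / (2 * v)))) s
    have hf : Measurable f := Measurable.indicator (by fun_prop) (hA.preimage (by fun_prop))
    have h1 : ∀ p : ℝ × ℝ, ((fun p : ℝ × ℝ => c * (p.1 ^ 2 + p.2 ^ 2)) ⁻¹' A).indicator
        (fun p => gaussianPDF 0 v.toNNReal p.1 * gaussianPDF 0 v.toNNReal p.2) p =
        f (p.1 ^ 2 + p.2 ^ 2) := by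
      intro p
      simp only [f, Set.indicator, gaussianPDF_mul_gaussianPDF hv]
      rfl
    have h2 : ∫⁻ s, A.indicator (fun s => gammaPDF 1 (2 * v * c)⁻¹ s) s =
        ∫⁻ s in Set.Ioi 0, A.indicator
          (fun s => ENNReal.ofReal ((2 * v * c)⁻¹ * Real.exp (-s / (2 * v * c)))) s := by
      rw [setLIntegral_congr (Ioi_ae_eq_Ici (a := (0 : ℝ))), ← lintegral_indicator measurableSet_Ici]
      refine lintegral_congr fun s => ?_
      by_cases hs : 0 ≤ s
      · rw [Set.indicator_of_mem (show s ∈ Set.Ici 0 from hs)]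
        simp only [Set.indicator]
        split_ifs
        · have := exponentialPDF_of_nonneg (r := (2 * v * c)⁻¹) hs
          rw [exponentialPDF, exponentialPDFReal] at this
          rw [gammaPDF, this]
          congr 3
          field_simp
        · rfl
      · rw [Set.indicator_of_notMem (show s ∉ Set.Ici 0 from hs)]
        simp only [Set.indicator]
        split_ifs
        · exact gammaPDF_of_neg (not_le.1 hs)
        · rfl
    rw [h2, lintegral_congr h1, ← Measure.volume_eq_prod, lintegral_polar_radial f hf]
    refine Eq.trans ?_ (lintegral_Ioi_comp_const_mul_sq hc _)
    refine setLIntegral_congr_fun measurableSet_Ioi fun ρ hρ => ?_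
    have hρ' : (0 : ℝ) < ρ := hρ
    by_cases hA' : c * ρ ^ 2 ∈ A
    · rw [Set.indicator_of_mem hA']
      simp only [f]
      rw [Set.indicator_of_mem (show ρ ^ 2 ∈ (fun s => c * s) ⁻¹' A from hA')]
      rw [← ENNReal.ofReal_mul (by positivity), ← ENNReal.ofReal_mul (by positivity)]
      congr 1
      have : -(c * ρ ^ 2) / (2 * v * c) = -ρ ^ 2 / (2 * v) := by
        field_simp
      rw [this]
      field_simp
    · rw [Set.indicator_of_notMem hA']
      simp only [f]
      rw [Set.indicator_of_notMem (show ρ ^ 2 ∉ (fun s => c * s) ⁻¹' A from hA'), mul_zero,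
        mul_zero]

/-! ### From integer boxes to the centred cubes with real side length -/

section Cubes

variable {d : ℕ}

/-- The cube `[0,r]^d`. -/
def cornerCube (d : ℕ) (r : ℝ) : Set (E d) := {x | ∀ i, x i ∈ Set.Icc 0 r}

theorem measurableSet_cornerCube (d : ℕ) (r : ℝ) : MeasurableSet (cornerCube d r) :=
  measurableSet_pi_box fun _ => measurableSet_Icc

theorem isBounded_cornerCube (d : ℕ) (r : ℝ) : Bornology.IsBounded (cornerCube d r) :=
  isBounded_pi_box fun _ => Metric.isBounded_Icc _ _

theorem volume_cornerCube (d : ℕ) {r : ℝ} (hr : 0 ≤ r) :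
    volume (cornerCube d r) = ENNReal.ofReal (r ^ d) := by
  rw [cornerCube, volume_pi_box fun _ => measurableSet_Icc]
  simp [Real.volume_Icc, ENNReal.ofReal_pow hr]

theorem measurableSet_cube (d : ℕ) (r : ℝ) : MeasurableSet (cube d r) :=
  measurableSet_pi_box fun _ => measurableSet_Icc

theorem isBounded_cube (d : ℕ) (r : ℝ) : Bornology.IsBounded (cube d r) :=
  isBounded_pi_box fun _ => Metric.isBounded_Icc _ _

theorem partialBox_floor_subset {r : ℝ} (hr : 0 ≤ r) :
    partialBox d d ⌊r⌋₊ ⊆ cornerCube d r := by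
  intro x hx i
  have h := hx i
  simp only [i.isLt, if_true] at h
  exact ⟨h.1, h.2.le.trans (Nat.floor_le hr)⟩

theorem preimage_cube (d : ℕ) (r : ℝ) :
    (fun y : E d => y + WithLp.toLp 2 fun _ => -r / 2) ⁻¹' cube d r = cornerCube d r := by
  ext y
  refine forall_congr' fun i => ?_
  simp only [PiLp.add_apply, Set.mem_Icc]
  constructor <;> rintro ⟨h1, h2⟩ <;> constructor <;> linarith

variable {m : Measure (Config d)}

/-- With `N = ⌊r⌋₊`, the points outside the integer box number `γ (r^d - N^d)` on average. Their
normalized mean and the change of normalization each cost `γ (1 - (N / r)^d)`, whence the factor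
`2`. -/
theorem integral_abs_cornerCube_le [IsProbabilityMeasure m]
    (hinv : ∀ x, MeasurePreserving (Config.shift x : Config d → Config d) m m)
    (hsq : IsLocallySquareIntegrable m (id : Config d → Config d)) {r : ℝ} (hr : 1 ≤ r) :
    ∫ μ, |(r ^ d)⁻¹ * Config.num (cornerCube d r) μ - intensity m id| ∂m ≤
      2 * intensity m id * (1 - ((⌊r⌋₊ : ℝ) / r) ^ d) +
        ∫ μ, |((⌊r⌋₊ : ℝ) ^ d)⁻¹ * Config.num (partialBox d d ⌊r⌋₊) μ - intensity m id| ∂m := by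
  have hr0 : 0 < r := by linarith
  set N := ⌊r⌋₊
  have hN : 0 < N := Nat.floor_pos.2 hr
  have hN' : (0 : ℝ) < N := by exact_mod_cast hN
  have hNr : (N : ℝ) ≤ r := Nat.floor_le hr0.le
  set γ := intensity m id
  have hγ : 0 ≤ γ := ENNReal.toReal_nonneg
  set w := ((N : ℝ) / r) ^ d with hw
  have hw0 : 0 ≤ w := by positivity
  have hw1 : w ≤ 1 := pow_le_one₀ (by positivity) ((div_le_one hr0).2 hNr)
  have hwN : (r ^ d)⁻¹ = w * ((N : ℝ) ^ d)⁻¹ := by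
    rw [hw, div_pow]
    field_simp
  have hq := integrable_num hsq (measurableSet_cornerCube d r) (isBounded_cornerCube d r)
  have hb := integrable_num hsq (measurableSet_partialBox d d N) (isBounded_partialBox d d N)
  have hD : Integrable (fun μ => (r ^ d)⁻¹ *
      (Config.num (cornerCube d r) μ - Config.num (partialBox d d N) μ)) m :=
    (hq.sub hb).const_mul _
  have hA : Integrable (fun μ => |((N : ℝ) ^ d)⁻¹ * Config.num (partialBox d d N) μ - γ|) m :=
    ((hb.const_mul _).sub (integrable_const _)).abs
  have hpt : ∀ μ : Config d, |(r ^ d)⁻¹ * Config.num (cornerCube d r) μ - γ| ≤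
      (r ^ d)⁻¹ * (Config.num (cornerCube d r) μ - Config.num (partialBox d d N) μ) +
        |((N : ℝ) ^ d)⁻¹ * Config.num (partialBox d d N) μ - γ| + γ * (1 - w) := by
    intro μ
    have h1 : 0 ≤ (r ^ d)⁻¹ *
        (Config.num (cornerCube d r) μ - Config.num (partialBox d d N) μ) :=
      mul_nonneg (by positivity) (sub_nonneg.2 (μ.num_mono (partialBox_floor_subset hr0.le)
        (isBounded_cornerCube d r)))
    set q := Config.num (cornerCube d r) μ
    set b := Config.num (partialBox d d N) μ
    have h2 : (r ^ d)⁻¹ * q - γ =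
        (r ^ d)⁻¹ * (q - b) + w * (((N : ℝ) ^ d)⁻¹ * b - γ) - γ * (1 - w) := by
      rw [hwN]
      ring
    have h3 : |w * (((N : ℝ) ^ d)⁻¹ * b - γ)| ≤ |((N : ℝ) ^ d)⁻¹ * b - γ| := by
      rw [abs_mul, abs_of_nonneg hw0]
      exact mul_le_of_le_one_left (abs_nonneg _) hw1
    have h4 : 0 ≤ γ * (1 - w) := mul_nonneg hγ (by linarith)
    rw [h2]
    refine abs_le.2 ⟨?_, ?_⟩
    · linarith [(abs_le.1 h3).1]
    · linarith [(abs_le.1 h3).2]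
  have hDint : ∫ μ, (r ^ d)⁻¹ *
      (Config.num (cornerCube d r) μ - Config.num (partialBox d d N) μ) ∂m = γ * (1 - w) := by
    rw [integral_const_mul, integral_sub hq hb,
      integral_num hinv hsq (measurableSet_cornerCube d r) (isBounded_cornerCube d r),
      integral_num hinv hsq (measurableSet_partialBox d d N) (isBounded_partialBox d d N),
      volume_cornerCube d hr0.le, volume_partialBox, ENNReal.toReal_ofReal (by positivity),
      ENNReal.toReal_ofReal (by positivity), hw, div_pow]
    field_simp
    exact mul_comm _ _
  refine (integral_mono ((hq.const_mul _).sub (integrable_const _)).abs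
    ((hD.add hA).add (integrable_const _)) hpt).trans (le_of_eq ?_)
  rw [integral_add' (hD.add hA) (integrable_const _), integral_add' hD hA, hDint]
  simp
  ring

theorem tendsto_integral_abs_cube [IsProbabilityMeasure m]
    (hinv : ∀ x, MeasurePreserving (Config.shift x : Config d → Config d) m m)
    (hsq : IsLocallySquareIntegrable m (id : Config d → Config d))
    (herg : IsErgodic m (id : Config d → Config d)) :
    Tendsto (fun r : ℝ => ∫ μ, |(r ^ d)⁻¹ * Config.num (cube d r) μ - intensity m id| ∂m)
      atTop (𝓝 0) := by
  -- Stationarity moves the centred cube to the corner cube.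
  have h1 : ∀ r : ℝ, ∫ μ, |(r ^ d)⁻¹ * Config.num (cube d r) μ - intensity m id| ∂m =
      ∫ μ, |(r ^ d)⁻¹ * Config.num (cornerCube d r) μ - intensity m id| ∂m := by
    intro r
    have hm := Config.measurable_num (measurableSet_cube d r)
    have hm' : Measurable fun μ : Config d =>
        |(r ^ d)⁻¹ * Config.num (cube d r) μ - intensity m id| :=
      ((hm.const_mul _).sub_const _).abs
    have h := hinv (WithLp.toLp 2 fun _ => -r / 2)
    have h' := integral_map h.measurable.aemeasurable
      (hm'.aestronglyMeasurable (μ := m.map _))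
    rw [h.map_eq] at h'
    simpa only [Config.num_shift, preimage_cube] using h'
  simp only [h1]
  have h2 : Tendsto (fun r : ℝ => 2 * intensity m id * (1 - ((⌊r⌋₊ : ℝ) / r) ^ d) +
      ∫ μ, |((⌊r⌋₊ : ℝ) ^ d)⁻¹ * Config.num (partialBox d d ⌊r⌋₊) μ - intensity m id| ∂m)
      atTop (𝓝 0) := by
    have h3 := (((tendsto_nat_floor_div_atTop (R := ℝ)).pow d).const_sub 1).const_mul
      (2 * intensity m id)
    have h4 := (tendsto_integral_abs_partialBox hinv hsq herg).comp
      (tendsto_nat_floor_atTop (α := ℝ))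
    simpa using h3.add h4
  refine squeeze_zero' (Eventually.of_forall fun r => integral_nonneg fun μ => abs_nonneg _) ?_ h2
  filter_upwards [eventually_ge_atTop 1] with r hr using integral_abs_cornerCube_le hinv hsq hr

end Cubes

/-! ### Convergence of the density and form of the scattering intensity -/

/-- Continuity at the limit point alone is enough; this matters because it is applied to inversion
at `γ > 0`, with `0⁻¹ = 0`. -/
theorem TendstoInMeasure.comp_continuousAt_const {Ω ι F G : Type*} [MeasurableSpace Ω]
    {P : Measure Ω} [PseudoEMetricSpace F] [PseudoEMetricSpace G] {l : Filter ι}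
    {Y : ι → Ω → F} {c : F} (hY : TendstoInMeasure P Y l fun _ => c) {φ : F → G}
    (hφ : ContinuousAt φ c) :
    TendstoInMeasure P (fun i ω => φ (Y i ω)) l fun _ => φ c := by
  intro ε hε
  obtain ⟨δ, hδ, h⟩ := EMetric.continuousAt_iff.1 hφ ε hε
  refine tendsto_of_tendsto_of_tendsto_of_le_of_le tendsto_const_nhds (hY δ hδ)
    (fun _ => zero_le) fun i => measure_mono fun ω hω => ?_
  by_contra hc
  exact absurd hω (not_le.2 (h (not_le.1 hc)))

section PointProcess

variable {Ω : Type*} [MeasurableSpace Ω] {P : Measure Ω} {d : ℕ}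
  {η : Ω → Config d}

theorem intensity_map (hη : Measurable η) : intensity (P.map η) id = intensity P η := by
  have hm := measurable_mul_count (measurableSet_pi_box (d := d) (s := fun _ => Set.Icc (0 : ℝ) 1)
    fun _ => measurableSet_Icc) 1
  simp only [one_mul] at hm
  rw [intensity, intensity]
  congr 1
  exact lintegral_map hm hη

/-- The ergodic theorem in probability: `η(W_r) / r^d` tends to the intensity. -/
theorem tendstoInMeasure_num_cube [IsProbabilityMeasure P] (hη : Measurable η) (hstat : IsStationary P η)
    (hL2 : IsLocallySquareIntegrable P η) (herg : IsErgodic P η) :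
    TendstoInMeasure P (fun (r : ℝ) ω => (r ^ d)⁻¹ * Config.num (cube d r) (η ω)) atTop
      fun _ => intensity P η := by
  -- The hypotheses are transferred to the law of `η`, on which translations act measure
  -- preservingly.
  have : IsProbabilityMeasure (P.map η) := Measure.isProbabilityMeasure_map hη.aemeasurable
  have hinv : ∀ x, MeasurePreserving (Config.shift x : Config d → Config d)
      (P.map η) (P.map η) := fun x =>
    ⟨Config.measurable_shift x, by
      rw [Measure.map_map (Config.measurable_shift x) hη]
      exact hstat x⟩
  have hsq : IsLocallySquareIntegrable (P.map η) (id : Config d → Config d) := by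
    intro B hB hb
    have hm := measurable_mul_count hB 1
    simp only [one_mul] at hm
    rw [lintegral_map (f := fun μ : Config d => ((id μ).count B : ℝ≥0∞) ^ 2) (hm.pow_const 2) hη]
    exact hL2 B hB hb
  have herg' : IsErgodic (P.map η) (id : Config d → Config d) := by
    intro A hA hA'
    rw [Set.preimage_id, Measure.map_apply hη hA]
    exact herg A hA hA'
  have hlim := tendsto_integral_abs_cube hinv hsq herg'
  have hm : ∀ r : ℝ, Measurable (Config.num (cube d r)) := fun r =>
    Config.measurable_num (measurableSet_cube d r)
  have hm' : ∀ r : ℝ, Measurable fun ω => (r ^ d)⁻¹ * Config.num (cube d r) (η ω) := fun r =>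
    ((hm r).comp hη).const_mul _
  refine tendstoInMeasure_of_tendsto_eLpNorm one_ne_zero
    (fun r => (hm' r).aestronglyMeasurable) aestronglyMeasurable_const ?_
  rw [← ENNReal.ofReal_zero]
  refine (ENNReal.tendsto_ofReal hlim).congr fun r => ?_
  have hi : Integrable (fun μ => (r ^ d)⁻¹ * Config.num (cube d r) μ - intensity P η)
      (P.map η) :=
    ((integrable_num hsq (measurableSet_cube d r) (isBounded_cube d r)).const_mul _).sub
      (integrable_const _)
  rw [intensity_map hη, integral_map hη.aemeasurable hi.abs.aestronglyMeasurable,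
    eLpNorm_one_eq_lintegral_enorm]
  exact ofReal_integral_norm_eq_lintegral_enorm (hi.comp_measurable hη)

theorem scatteringIntensity_eq {r : ℝ} (hr : 0 < r) (k : E d) (ω : Ω) :
    scatteringIntensity P η r k ω =
      ((r ^ d)⁻¹ * Config.num (cube d r) (η ω))⁻¹ * ‖T P η r k ω‖ ^ 2 := by
  set a : ℝ := r ^ ((d : ℝ) / 2) with ha
  have ha0 : 0 < a := Real.rpow_pos_of_pos hr _
  have haa : r ^ d = a ^ 2 := by
    rw [ha, ← Real.rpow_natCast, ← Real.rpow_natCast, ← Real.rpow_mul hr.le]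
    congr 1
    push_cast
    ring
  have haC : (a : ℂ) ≠ 0 := by exact_mod_cast ha0.ne'
  have hT : T P η r k ω = (a : ℂ)⁻¹ * (expSum (η ω) r k -
      (if k = 0 then ((intensity P η * r ^ d : ℝ) : ℂ) else 0)) := by
    rw [T, ← ha, haa]
    split_ifs
    · push_cast
      field_simp
    · simp
  rw [hT, norm_mul, norm_inv, Complex.norm_real, Real.norm_of_nonneg ha0.le, haa,
    scatteringIntensity, haa, Config.num, mul_pow, mul_inv, inv_inv, inv_pow]
  field_simp

theorem expSum_zero (μ : Config d) (r : ℝ) : expSum μ r 0 = (μ.num (cube d r) : ℂ) := by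
  rw [expSum, Config.num, Config.count]
  have hfin := μ.2 _ (isBounded_cube d r)
  rw [finsum_mem_eq_finite_toFinset_sum _ hfin, hfin.encard_eq_coe_toFinset_card]
  simp

/-- Convergence in distribution asks for measurability at every real `r`. For `r < 0` the cube is
empty because `d ≥ 1`; for `r = 0` division by zero makes the wave vector `0`, and the exponential
sum is a count. -/
theorem measurable_scatteringIntensity_of_nonpos (hd : 1 ≤ d) (hη : Measurable η) {r : ℝ}
    (hr : r ≤ 0) (H : Fin d → ℕ+) :
    Measurable (scatteringIntensity P η r (waveVector r H)) := by
  rcases hr.lt_or_eq with hr | rfl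
  · have hempty : cube d r = ∅ := by
      refine Set.eq_empty_of_forall_notMem fun x hx => ?_
      have := hx ⟨0, hd⟩
      linarith [this.1, this.2]
    have : scatteringIntensity P η r (waveVector r H) = fun _ => 0 := by
      funext ω
      simp [scatteringIntensity, hempty, Config.count]
    rw [this]
    exact measurable_const
  · have hk : waveVector 0 H = (0 : E d) := by
      ext i
      simp [waveVector]
    have hm := (Config.measurable_num (measurableSet_cube d 0)).comp hη
    have : scatteringIntensity P η 0 (waveVector 0 H) = fun ω =>
        (Config.num (cube d 0) (η ω))⁻¹ *
          ‖((Config.num (cube d 0) (η ω) - intensity P η * 0 ^ d : ℝ) : ℂ)‖ ^ 2 := by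
      funext ω
      rw [scatteringIntensity, hk, expSum_zero, if_pos rfl, ← Complex.ofReal_sub]
      rfl
    rw [this]
    simp only [Function.comp_def] at hm
    fun_prop

end PointProcess

theorem map_pi_complexGaussian {n : ℕ} {γ : ℝ} (hγ : 0 < γ) (s : Fin n → ℝ) :
    (Measure.pi fun j => complexGaussian (γ * s j / 2)).map
      (fun z j => γ⁻¹ * ‖z j‖ ^ 2) = Measure.pi fun j => expLaw (s j) := by
  have h : ∀ j, (complexGaussian (γ * s j / 2)).map (fun z : ℂ => γ⁻¹ * ‖z‖ ^ 2) =
      expLaw (s j) := by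
    intro j
    rw [map_complexGaussian _ (inv_pos.2 hγ)]
    congr 1
    field_simp
  have hm : Measurable fun z : ℂ => γ⁻¹ * ‖z‖ ^ 2 := by fun_prop
  have : ∀ j, SigmaFinite ((complexGaussian (γ * s j / 2)).map fun z : ℂ => γ⁻¹ * ‖z‖ ^ 2) := by
    intro j
    rw [h]
    infer_instance
  rw [Measure.pi_map_pi (f := fun _ (z : ℂ) => γ⁻¹ * ‖z‖ ^ 2) fun _ => hm.aemeasurable]
  simp only [h]

end Scattering

end

/-! ### The limit theorem -/

theorem mainTheorem3 {Ω : Type*} [MeasurableSpace Ω] (P : Measure Ω) [IsProbabilityMeasure P]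
    (d : ℕ) (hd : 1 ≤ d)
    (η : Ω → Scattering.Config d) (hη : Measurable η)
    (hstat : Scattering.IsStationary P η)
    (hγ : 0 < Scattering.intensity P η)
    (hL2 : Scattering.IsLocallySquareIntegrable P η)
    (S : Scattering.E d → ℝ) (hS : Scattering.IsStructureFactor P η S)
    (herg : Scattering.IsErgodic P η)
    (K : Set (Scattering.E d)) (hK : Scattering.IsHalfSpace K)
    (hgood : Scattering.IsGood P η S K)
    (n : ℕ) (k : Fin n → Scattering.E d) (hk : Function.Injective k)
    (hkK : ∀ j, k j ∈ K \ {0})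
    (H : Fin n → ℝ → Fin d → ℕ+)
    (hH : ∀ j, Tendsto (fun r => Scattering.waveVector r (H j r)) atTop (𝓝 (k j))) :
    TendstoInDistribution
      (fun (r : ℝ) (ω : Ω) (j : Fin n) =>
        Scattering.scatteringIntensity P η r (Scattering.waveVector r (H j r)) ω)
      atTop (id : (Fin n → ℝ) → (Fin n → ℝ)) (fun _ => P)
      (Measure.pi fun j => Scattering.expLaw (S (k j))) := by
  have hT := hgood n k hk hkK H hH
  set γ := Scattering.intensity P η with hγdef
  -- The inverse density tends to `γ⁻¹` in probability, the second input to Slutsky's lemma.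
  have hY := Scattering.TendstoInMeasure.comp_continuousAt_const
    (Scattering.tendstoInMeasure_num_cube hη hstat hL2 herg) (continuousAt_inv₀ hγ.ne')
  have hYm : ∀ r : ℝ, Measurable fun ω =>
      ((r ^ d)⁻¹ * Scattering.Config.num (Scattering.cube d r) (η ω))⁻¹ := fun r =>
    (((Scattering.Config.measurable_num (Scattering.measurableSet_cube d r)).comp hη).const_mul
      _).inv
  have hg : Continuous fun p : (Fin n → ℂ) × ℝ => fun j => p.2 * ‖p.1 j‖ ^ 2 := by fun_prop
  have hlim := hT.continuous_comp_prodMk_of_tendstoInMeasure_const hg hY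
    fun r => (hYm r).aemeasurable
  have hmeas : ∀ r : ℝ, AEMeasurable (fun (ω : Ω) (j : Fin n) =>
      Scattering.scatteringIntensity P η r (Scattering.waveVector r (H j r)) ω) P := by
    intro r
    rcases le_or_gt r 0 with hr | hr
    · exact (measurable_pi_lambda _ fun j =>
        Scattering.measurable_scatteringIntensity_of_nonpos hd hη hr (H j r)).aemeasurable
    · refine (hlim.forall_aemeasurable r).congr (Eventually.of_forall fun ω => ?_)
      funext j
      exact (Scattering.scatteringIntensity_eq hr _ ω).symm
  -- The factorization holds only for `r > 0`, so the two families agree eventually; their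
  -- difference is then zero, which suffices to transfer the limit.
  have hdist := tendstoInDistribution_of_tendstoInMeasure_sub
    (fun (r : ℝ) (ω : Ω) (j : Fin n) =>
      Scattering.scatteringIntensity P η r (Scattering.waveVector r (H j r)) ω) _ hlim
    (by
      intro ε hε
      refine tendsto_const_nhds.congr' ?_
      filter_upwards [eventually_gt_atTop 0] with r hr
      refine (measure_mono_null (fun ω hω => ?_) measure_empty).symm
      refine hε.not_ge (le_trans hω (edist_eq_zero.2 ?_).le)
      funext j
      simp [Scattering.scatteringIntensity_eq hr])
    hmeas
  refine ⟨hmeas, aemeasurable_id, ?_⟩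
  convert hdist.tendsto using 2
  refine congrArg 𝓝 (Subtype.ext ?_)
  exact Measure.map_id.trans (Scattering.map_pi_complexGaussian hγ fun j => S (k j)).symm
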